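/- Let $X,Y$ be real Banach lattices and let $1\le q\le p\le\infty$. For $s\in[1,\infty]$ let $s'$ denote the conjugate exponent, $1/s+1/s'=1$. For finitely many elements $x_1,\dots,x_n$ of a Banach lattice $E$, let $\big(\sum_{i}|x_i|^s\big)^{1/s}\in E$ denote the least upper bound, in the order of $E$, of the set $\{\sum_i a_ix_i : a\in\mathbb R^n,\ \|a\|_{\ell_{s'}}\le 1\}$ (it exists, and for $s=\infty$ it is $\bigvee_i|x_i|$). The dual $Y^*$ is a Banach lattice in the dual norm and the order given by the positive functionals. A linear map $T:X\to Y$ is \emph{$(p,q)$-regular} if there is $K>0$ such that $$\Big\|\Big(\sum_{i=1}^n|Tx_i|^p\Big)^{1/p}\Big\|_Y\le K\,\Big\|\Big(\sum_{i=1}^n|x_i|^q\Big)^{1/q}\Big\|_X\qquad\text{for all } n \text{ and all } x_1,\dots,x_n\in X.$$ Let $\mathcal R_{p,q}(X,Y)$ be the space of all such maps, with the norm $\rho_{p,q}(T)$, the smallest constant $K\ge 0$ for which the inequality holds. For Banach lattices $X,Z$ and $z\in X\otimes Z$ (algebraic tensor product) put $$\phi_{p,q}(z)=\inf\Big\{\Big\|\Big(\sum_i|x_i|^q\Big)^{1/q}\Big\|_X\Big\|\Big(\sum_i|y_i|^{p'}\Big)^{1/p'}\Big\|_Z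 : z=\sum_{i=1}^n x_i\otimes y_i\Big\},$$ $$r_{p,q}(z)=\inf\Big\{\sum_{j=1}^m\phi_{p,q}(z_j): z=\sum_{j=1}^m z_j\Big\},$$ and let $X\otimes_{r_{p,q}}Z$ be $X\otimes Z$ with the seminorm $r_{p,q}$. To every bounded functional $\varphi$ on $X\otimes_{r_{p,q}}Y^*$ trace duality attaches the bounded operator $T_\varphi:X\to Y^{**}$, $\langle T_\varphi x,y^*\rangle=\varphi(x\otimes y^*)$. Let $(X\otimes_{r_{p,q}}Y^*)^*\cap\mathcal L(X,Y)$ be the space, with the dual norm, of those $\varphi$ for which $T_\varphi$ is a bounded operator from $X$ into $Y$, where $Y\subseteq Y^{**}$ canonically. Then $$\mathcal R_{p,q}(X,Y)=\big(X\otimes_{r_{p,q}}Y^*\big)^*\cap\mathcal L(X,Y)\quad\text{isometrically:}$$ there is a linear bijection $T\mapsto\varphi_T$ from $\mathcal R_{p,q}(X,Y)$ onto $(X\otimes_{r_{p,q}}Y^*)^*\cap\mathcal L(X,Y)$ such that $T_{\varphi_T}=T$, that is, $\varphi_T(x\otimes y^*)=\langle Tx,y^*\rangle$ for all $x\in X$,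 $y^*\in Y^*$, and $\|\varphi_T\|=\rho_{p,q}(T)$ for all $T\in\mathcal R_{p,q}(X,Y)$. -/

import Mathlib

open scoped ENNReal TensorProduct

set_option linter.unusedSectionVars false

/-! ### The dual of a normed lattice as a normed lattice

Real Banach lattices are complete real normed spaces with a compatible lattice order and a solid
norm. Their duals carry the order given by the cone of positive functionals. -/

section DualLattice

variable {E : Type*} [NormedAddCommGroup E] [NormedSpace ℝ E] [Lattice E] [IsOrderedAddMonoid E]
  [HasSolidNorm E]

/-- The value at `x ≥ 0` of the positive part of `f` (Riesz-Kantorovich formula):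
`sup {f u : 0 ≤ u ≤ x}`. -/
noncomputable def dualPosAux (f : StrongDual ℝ E) (x : E) : ℝ := sSup (f '' Set.Icc 0 x)

theorem norm_le_of_nonneg_le {u x : E} (h0 : 0 ≤ u) (h : u ≤ x) : ‖u‖ ≤ ‖x‖ := by
  apply norm_le_norm_of_abs_le_abs
  rwa [abs_of_nonneg h0, abs_of_nonneg (h0.trans h)]

theorem apply_le_of_mem_Icc (f : StrongDual ℝ E) {u x : E} (hu : u ∈ Set.Icc 0 x) :
    f u ≤ ‖f‖ * ‖x‖ :=
  (le_abs_self _).trans ((f.le_opNorm u).trans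
    (mul_le_mul_of_nonneg_left (norm_le_of_nonneg_le hu.1 hu.2) (norm_nonneg _)))

theorem dualPosAux_bdd (f : StrongDual ℝ E) (x : E) : BddAbove (f '' Set.Icc 0 x) := by
  refine ⟨‖f‖ * ‖x‖, ?_⟩
  rintro _ ⟨u, hu, rfl⟩
  exact apply_le_of_mem_Icc f hu

theorem dualPosAux_add (f : StrongDual ℝ E) {x y : E} (hx : 0 ≤ x) (hy : 0 ≤ y) :
    dualPosAux f (x + y) = dualPosAux f x + dualPosAux f y := by
  unfold dualPosAux
  rw [← csSup_add ((Set.nonempty_Icc.2 hx).image _) (dualPosAux_bdd f x)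
    ((Set.nonempty_Icc.2 hy).image _) (dualPosAux_bdd f y)]
  congr 1
  ext t
  constructor
  · rintro ⟨w, ⟨hw0, hw⟩, rfl⟩
    refine ⟨f (w ⊓ x), ⟨w ⊓ x, ⟨le_inf hw0 hx, inf_le_right⟩, rfl⟩, f (w - w ⊓ x),
      ⟨w - w ⊓ x, ⟨sub_nonneg.2 inf_le_left, ?_⟩, rfl⟩, ?_⟩
    · have h : w - y ≤ w ⊓ x := le_inf (sub_le_self _ hy) (sub_le_iff_le_add.2 hw)
      exact sub_le_comm.1 h
    · simp
  · rintro ⟨_, ⟨u, hu, rfl⟩, _, ⟨v, hv, rfl⟩, rfl⟩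
    exact ⟨u + v, ⟨add_nonneg hu.1 hv.1, add_le_add hu.2 hv.2⟩, by simp⟩

theorem dualPosAux_nonneg (f : StrongDual ℝ E) {x : E} (hx : 0 ≤ x) : 0 ≤ dualPosAux f x :=
  le_csSup (dualPosAux_bdd f x) ⟨0, ⟨le_rfl, hx⟩, by simp⟩

theorem dualPosAux_le (f : StrongDual ℝ E) {x : E} (hx : 0 ≤ x) :
    dualPosAux f x ≤ ‖f‖ * ‖x‖ := by
  apply csSup_le ((Set.nonempty_Icc.2 hx).image _)
  rintro _ ⟨u, hu, rfl⟩
  exact apply_le_of_mem_Icc f hu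

theorem dualPosAux_sub (f : StrongDual ℝ E) {x a b : E} (ha : 0 ≤ a) (hb : 0 ≤ b)
    (h : x = a - b) :
    dualPosAux f x⁺ - dualPosAux f x⁻ = dualPosAux f a - dualPosAux f b := by
  have h1 : x⁺ + b = a + x⁻ := by
    have := posPart_sub_negPart x
    rw [sub_eq_iff_eq_add] at this
    rw [this]; nth_rw 1 [h]; abel
  have h2 := dualPosAux_add f (posPart_nonneg x) hb
  have h3 := dualPosAux_add f ha (negPart_nonneg x)
  rw [h1] at h2
  linarith

/-- The positive part of a continuous functional. -/
noncomputable def dualPos (f : StrongDual ℝ E) : StrongDual ℝ E :=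
  AddMonoidHom.toRealLinearMap
    { toFun := fun x => dualPosAux f x⁺ - dualPosAux f x⁻
      map_zero' := by simp
      map_add' := fun x y => by
        have := dualPosAux_sub f (x := x + y) (a := x⁺ + y⁺) (b := x⁻ + y⁻)
          (add_nonneg (posPart_nonneg _) (posPart_nonneg _))
          (add_nonneg (negPart_nonneg _) (negPart_nonneg _)) (by
            nth_rw 1 [← posPart_sub_negPart x, ← posPart_sub_negPart y]; abel)
        rw [this, dualPosAux_add f (posPart_nonneg _) (posPart_nonneg _),
          dualPosAux_add f (negPart_nonneg _) (negPart_nonneg _)]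
        ring }
    (by
      apply AddMonoidHomClass.continuous_of_bound _ ‖f‖
      intro x
      have hp : ‖x⁺‖ ≤ ‖x‖ := by
        rw [← norm_abs_eq_norm x]
        exact norm_le_of_nonneg_le (posPart_nonneg _) (sup_le (le_abs_self x) (abs_nonneg x))
      have hn : ‖x⁻‖ ≤ ‖x‖ := by
        rw [← norm_abs_eq_norm x]
        exact norm_le_of_nonneg_le (negPart_nonneg _) (sup_le (neg_le_abs x) (abs_nonneg x))
      have h1 := dualPosAux_le f (posPart_nonneg x)
      have h2 := dualPosAux_le f (negPart_nonneg x)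
      have h3 := dualPosAux_nonneg f (posPart_nonneg x)
      have h4 := dualPosAux_nonneg f (negPart_nonneg x)
      have h5 := mul_le_mul_of_nonneg_left hp (norm_nonneg f)
      have h6 := mul_le_mul_of_nonneg_left hn (norm_nonneg f)
      show |dualPosAux f x⁺ - dualPosAux f x⁻| ≤ _
      rw [abs_le]
      constructor <;> linarith)

theorem dualPos_apply (f : StrongDual ℝ E) {x : E} (hx : 0 ≤ x) :
    dualPos f x = dualPosAux f x := by
  have h := dualPosAux_sub f (x := x) hx le_rfl (sub_zero x).symm
  have h0 : dualPosAux f (0 : E) = 0 := by simp [dualPosAux]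
  rw [h0, sub_zero] at h
  exact h

/-- `f ≤ g` in the dual means `f x ≤ g x` for all `x ≥ 0`. -/
noncomputable instance dualPartialOrder : PartialOrder (StrongDual ℝ E) where
  le f g := ∀ x : E, 0 ≤ x → f x ≤ g x
  le_refl _ _ _ := le_rfl
  le_trans _ _ _ h1 h2 x hx := (h1 x hx).trans (h2 x hx)
  le_antisymm f g h1 h2 := by
    ext x
    rw [← posPart_sub_negPart x, map_sub, map_sub,
      le_antisymm (h1 _ (posPart_nonneg x)) (h2 _ (posPart_nonneg x)),
      le_antisymm (h1 _ (negPart_nonneg x)) (h2 _ (negPart_nonneg x))]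

theorem dual_le_def {f g : StrongDual ℝ E} : f ≤ g ↔ ∀ x : E, 0 ≤ x → f x ≤ g x := Iff.rfl

theorem le_dualPos (f : StrongDual ℝ E) : f ≤ dualPos f := fun x hx => by
  rw [dualPos_apply f hx]
  exact le_csSup (dualPosAux_bdd f x) ⟨x, ⟨hx, le_rfl⟩, rfl⟩

theorem dualPos_nonneg (f : StrongDual ℝ E) : 0 ≤ dualPos f := fun x hx => by
  rw [dualPos_apply f hx]
  exact dualPosAux_nonneg f hx

theorem dualPos_le {f g : StrongDual ℝ E} (h : f ≤ g) (h0 : 0 ≤ g) : dualPos f ≤ g :=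
  fun x hx => by
    rw [dualPos_apply f hx]
    apply csSup_le ((Set.nonempty_Icc.2 hx).image _)
    rintro _ ⟨u, hu, rfl⟩
    have h1 := h u hu.1
    have h2 := h0 (x - u) (sub_nonneg.2 hu.2)
    rw [map_sub g, _root_.zero_apply] at h2
    linarith

noncomputable instance dualLattice : Lattice (StrongDual ℝ E) where
  sup f g := g + dualPos (f - g)
  inf f g := f - dualPos (f - g)
  le_sup_left f g x hx := by
    have := le_dualPos (f - g) x hx
    simp only [_root_.sub_apply, _root_.add_apply] at *
    linarith
  le_sup_right f g x hx := by
    have := dualPos_nonneg (f - g) x hx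
    simp only [_root_.zero_apply, _root_.add_apply] at *
    linarith
  sup_le f g k h1 h2 x hx := by
    have := dualPos_le (f := f - g) (g := k - g)
      (fun x hx => by have := h1 x hx; simpa using this)
      (fun x hx => by have := h2 x hx; simpa using this) x hx
    simp only [_root_.sub_apply, _root_.add_apply] at *
    linarith
  inf_le_left f g x hx := by
    have := dualPos_nonneg (f - g) x hx
    simp only [_root_.zero_apply, _root_.sub_apply] at *
    linarith
  inf_le_right f g x hx := by
    have := le_dualPos (f - g) x hx
    simp only [_root_.sub_apply] at *
    linarith
  le_inf k f g h1 h2 x hx := by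
    have := dualPos_le (f := f - g) (g := f - k)
      (fun x hx => by have := h2 x hx; simp only [_root_.sub_apply]; linarith)
      (fun x hx => by have := h1 x hx; simpa using this) x hx
    simp only [_root_.sub_apply] at *
    linarith

instance dualIsOrderedAddMonoid : IsOrderedAddMonoid (StrongDual ℝ E) where
  add_le_add_left f g h k x hx := by
    simpa using h x hx

instance dualIsOrderedModule : IsOrderedModule ℝ (StrongDual ℝ E) where
  smul_le_smul_of_nonneg_left c hc f g h x hx := by
    simpa using mul_le_mul_of_nonneg_left (h x hx) hc
  smul_le_smul_of_nonneg_right f hf c d h x hx := by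
    have := hf x hx
    simpa using mul_le_mul_of_nonneg_right h (by simpa using this)

theorem dual_abs_apply_le (f : StrongDual ℝ E) {x : E} (hx : 0 ≤ x) : |f| x ≤ ‖f‖ * ‖x‖ := by
  have h2 : |f| = dualPos (f - -f) - f := by
    show -f + dualPos (f - -f) = _
    abel
  rw [h2, _root_.sub_apply, dualPos_apply _ hx, sub_le_iff_le_add]
  apply csSup_le ((Set.nonempty_Icc.2 hx).image _)
  rintro _ ⟨u, hu, rfl⟩
  rw [← sub_le_iff_le_add]
  have h3 : (f - -f) u - f x = f (u - (x - u)) := by simp; ring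
  rw [h3]
  refine (le_abs_self _).trans ((f.le_opNorm _).trans
    (mul_le_mul_of_nonneg_left ?_ (norm_nonneg _)))
  apply norm_le_norm_of_abs_le_abs
  rw [abs_of_nonneg hx]
  have h4 : 0 ≤ x - u := sub_nonneg.2 hu.2
  apply abs_le'.2
  constructor
  · calc u - (x - u) ≤ u := sub_le_self _ h4
      _ ≤ x := hu.2
  · rw [neg_sub]
    exact (sub_le_self _ hu.1).trans (sub_le_self _ hu.1)

instance dualHasSolidNorm : HasSolidNorm (StrongDual ℝ E) where
  solid f g h := by
    refine f.opNorm_le_bound (norm_nonneg _) fun x => ?_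
    have h1 : |f| |x| ≤ |g| |x| := h _ (abs_nonneg x)
    have h2 : |g| |x| ≤ ‖g‖ * ‖x‖ := by
      simpa [norm_abs_eq_norm] using dual_abs_apply_le g (abs_nonneg x)
    have hp := le_abs_self f _ (posPart_nonneg x)
    have hn := le_abs_self f _ (negPart_nonneg x)
    have hp' := neg_le_abs f _ (posPart_nonneg x)
    have hn' := neg_le_abs f _ (negPart_nonneg x)
    have h3 : |f| |x| = |f| x⁺ + |f| x⁻ := by rw [← map_add, posPart_add_negPart]
    have h4 : f x = f x⁺ - f x⁻ := by rw [← map_sub, posPart_sub_negPart]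
    simp only [_root_.neg_apply] at hp' hn'
    rw [Real.norm_eq_abs, abs_le]
    constructor <;> linarith

end DualLattice

/-! ### The elements `(∑ |x i| ^ p) ^ (1 / p)` of a Banach lattice -/

/-- The conjugate exponent `p'` of `p ∈ [1, ∞]`, with `1 / p + 1 / p' = 1`. -/
noncomputable def conjExp (p : ℝ≥0∞) : ℝ≥0∞ := (1 - p⁻¹)⁻¹

theorem one_le_conjExp (p : ℝ≥0∞) : 1 ≤ conjExp p := by
  unfold conjExp
  rw [ENNReal.one_le_inv]
  exact tsub_le_self

theorem exists_isLUB_of_finite_approx {E : Type*} [NormedAddCommGroup E] [NormedSpace ℝ E]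
    [CompleteSpace E] [Lattice E] [IsOrderedAddMonoid E] [HasSolidNorm E] [IsOrderedModule ℝ E]
    (S : Set E) (e : E) (he : 0 ≤ e)
    (h : ∀ ε : ℝ, 0 < ε → ∃ F : Finset E, F.Nonempty ∧ (F : Set E) ⊆ S ∧
      ∀ s ∈ S, ∃ f ∈ F, s ≤ f + ε • e) : ∃ u, IsLUB S u := by
  have hε : ∀ k : ℕ, (0 : ℝ) < (1 / 2) ^ k := fun k => by positivity
  choose F hne hFS hF using fun k : ℕ => h ((1 / 2) ^ k) (hε k)
  let u : ℕ → E := fun k => (F k).sup' (hne k) id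
  have hS : ∀ k, ∀ s ∈ S, s ≤ u k + ((1 / 2 : ℝ) ^ k) • e := by
    intro k s hs
    obtain ⟨f, hf, hsf⟩ := hF k s hs
    exact hsf.trans (add_le_add (Finset.le_sup' id hf) le_rfl)
  have hu : ∀ m k, u m ≤ u k + ((1 / 2 : ℝ) ^ k) • e := by
    intro m k
    exact Finset.sup'_le _ _ fun f hf => hS k f (hFS m hf)
  have hstep : ∀ k, dist (u k) (u (k + 1)) ≤ ‖e‖ * (1 / 2) ^ k := by
    intro k
    rw [dist_eq_norm]
    have h1 : |u k - u (k + 1)| ≤ ((1 / 2 : ℝ) ^ k) • e := by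
      apply abs_le'.2
      constructor
      · rw [sub_le_iff_le_add']
        refine (hu k (k + 1)).trans (add_le_add le_rfl ?_)
        exact smul_le_smul_of_nonneg_right
          (pow_le_pow_of_le_one (by norm_num) (by norm_num) (Nat.le_succ k)) he
      · rw [neg_sub, sub_le_iff_le_add']
        exact hu (k + 1) k
    have h2 : ‖u k - u (k + 1)‖ ≤ ‖((1 / 2 : ℝ) ^ k) • e‖ := by
      apply norm_le_norm_of_abs_le_abs
      rwa [abs_of_nonneg (smul_nonneg (hε k).le he)]
    rw [norm_smul, Real.norm_of_nonneg (hε k).le, mul_comm] at h2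
    exact h2
  obtain ⟨v, hv⟩ := cauchySeq_tendsto_of_complete
    (cauchySeq_of_le_geometric (1 / 2) ‖e‖ (by norm_num) hstep)
  refine ⟨v, fun s hs => ?_, fun b hb => ?_⟩
  · have h1 : Filter.Tendsto (fun k => u k + ((1 / 2 : ℝ) ^ k) • e) Filter.atTop
        (nhds (v + (0 : ℝ) • e)) :=
      hv.add ((tendsto_pow_atTop_nhds_zero_of_lt_one (by norm_num) (by norm_num)).smul_const e)
    rw [zero_smul, add_zero] at h1
    exact ge_of_tendsto' h1 fun k => hS k s hs
  · exact le_of_tendsto' hv fun k => Finset.sup'_le _ _ fun f hf => hb (hFS k hf)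

section LpSum

variable {E : Type*} [NormedAddCommGroup E] [NormedSpace ℝ E]

/-- The set of all `∑ i, a i • x i` with `(∑ |a i| ^ p') ^ (1 / p') ≤ 1` (with `max |a i| ≤ 1` if
`p = 1`). -/
def lpComb (p : ℝ≥0∞) {n : ℕ} (x : Fin n → E) : Set E :=
  {z | ∃ a : PiLp (conjExp p) (fun _ : Fin n => ℝ), ‖a‖ ≤ 1 ∧ z = ∑ i, a i • x i}

theorem zero_mem_lpComb (p : ℝ≥0∞) {n : ℕ} (x : Fin n → E) : (0 : E) ∈ lpComb p x := by
  have : Fact (1 ≤ conjExp p) := ⟨one_le_conjExp p⟩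
  exact ⟨0, by simp, by simp⟩

theorem neg_mem_lpComb {p : ℝ≥0∞} {n : ℕ} {x : Fin n → E} {z : E} (hz : z ∈ lpComb p x) :
    -z ∈ lpComb p x := by
  have : Fact (1 ≤ conjExp p) := ⟨one_le_conjExp p⟩
  obtain ⟨a, ha, rfl⟩ := hz
  exact ⟨-a, by rwa [norm_neg], by simp⟩

variable [Lattice E] [IsOrderedAddMonoid E] [HasSolidNorm E] [IsOrderedModule ℝ E]

theorem smul_le_abs_smul_abs (c : ℝ) (x : E) : c • x ≤ |c| • |x| := by
  rcases le_total 0 c with h | h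
  · rw [abs_of_nonneg h]
    exact smul_le_smul_of_nonneg_left (le_abs_self x) h
  · rw [abs_of_nonpos h, ← neg_smul_neg]
    exact smul_le_smul_of_nonneg_left (neg_le_abs x) (neg_nonneg.2 h)

variable [CompleteSpace E]

theorem exists_isLUB_lpComb (p : ℝ≥0∞) {n : ℕ} (x : Fin n → E) :
    ∃ u, IsLUB (lpComb p x) u := by
  classical
  have : Fact (1 ≤ conjExp p) := ⟨one_le_conjExp p⟩
  refine exists_isLUB_of_finite_approx _ (∑ i, |x i|)
    (Finset.sum_nonneg fun i _ => abs_nonneg _) fun ε hε => ?_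
  have hc : IsCompact (Metric.closedBall (0 : PiLp (conjExp p) (fun _ : Fin n => ℝ)) 1) :=
    isCompact_closedBall _ _
  obtain ⟨t, htB, htf, ht⟩ := Metric.finite_approx_of_totallyBounded hc.totallyBounded ε hε
  have h0 : (0 : PiLp (conjExp p) (fun _ : Fin n => ℝ)) ∈ ⋃ y ∈ t, Metric.ball y ε :=
    ht (by simp)
  obtain ⟨t0, ht0, -⟩ := Set.mem_iUnion₂.1 h0
  refine ⟨htf.toFinset.image fun a => ∑ i, a i • x i,
    ⟨_, Finset.mem_image_of_mem _ (htf.mem_toFinset.2 ht0)⟩, ?_, ?_⟩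
  · intro z hz
    obtain ⟨a, ha, rfl⟩ := Finset.mem_image.1 (Finset.mem_coe.1 hz)
    exact ⟨a, by simpa using htB (htf.mem_toFinset.1 ha), rfl⟩
  · rintro _ ⟨a, ha, rfl⟩
    obtain ⟨b, hb, hab⟩ := Set.mem_iUnion₂.1 (ht (by simpa using ha : a ∈ Metric.closedBall 0 1))
    refine ⟨_, Finset.mem_image_of_mem _ (htf.mem_toFinset.2 hb), ?_⟩
    rw [← sub_le_iff_le_add', ← Finset.sum_sub_distrib, Finset.smul_sum]
    refine Finset.sum_le_sum fun i _ => ?_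
    rw [← sub_smul]
    refine (smul_le_abs_smul_abs _ _).trans (smul_le_smul_of_nonneg_right ?_ (abs_nonneg _))
    have h1 := PiLp.norm_apply_le (a - b) i
    rw [Metric.mem_ball, dist_eq_norm] at hab
    exact h1.trans hab.le

/-- For `1 ≤ p ≤ ∞`, the element `(∑ i, |x i| ^ p) ^ (1 / p)` of the Banach lattice `E`
(`⋁ i, |x i|` for `p = ∞`): the least upper bound, in the order of `E`, of all `∑ i, a i • x i`
with `(∑ |a i| ^ p') ^ (1 / p') ≤ 1`. -/
noncomputable def lpSum (p : ℝ≥0∞) {n : ℕ} (x : Fin n → E) : E :=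
  Classical.choose (exists_isLUB_lpComb p x)

theorem isLUB_lpSum (p : ℝ≥0∞) {n : ℕ} (x : Fin n → E) : IsLUB (lpComb p x) (lpSum p x) :=
  Classical.choose_spec (exists_isLUB_lpComb p x)

theorem lpSum_nonneg (p : ℝ≥0∞) {n : ℕ} (x : Fin n → E) : 0 ≤ lpSum p x :=
  (isLUB_lpSum p x).1 (zero_mem_lpComb p x)

theorem norm_lpSum_zero (p : ℝ≥0∞) {n : ℕ} : ‖lpSum p (0 : Fin n → E)‖ = 0 := by
  have h : lpSum p (0 : Fin n → E) ≤ 0 := (isLUB_lpSum p _).2 (by rintro _ ⟨a, -, rfl⟩; simp)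
  rw [le_antisymm h (lpSum_nonneg p _), norm_zero]

theorem norm_lpSum_add_le (p : ℝ≥0∞) {n : ℕ} (x y : Fin n → E) :
    ‖lpSum p (x + y)‖ ≤ ‖lpSum p x‖ + ‖lpSum p y‖ := by
  refine (norm_le_of_nonneg_le (lpSum_nonneg p _) ?_).trans (norm_add_le _ _)
  refine (isLUB_lpSum p _).2 ?_
  rintro _ ⟨a, ha, rfl⟩
  simp only [Pi.add_apply, smul_add, Finset.sum_add_distrib]
  exact add_le_add ((isLUB_lpSum p x).1 ⟨a, ha, rfl⟩) ((isLUB_lpSum p y).1 ⟨a, ha, rfl⟩)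

theorem norm_lpSum_smul_le (p : ℝ≥0∞) {n : ℕ} (c : ℝ) (x : Fin n → E) :
    ‖lpSum p (c • x)‖ ≤ |c| * ‖lpSum p x‖ := by
  have h : lpSum p (c • x) ≤ |c| • lpSum p x := by
    refine (isLUB_lpSum p _).2 ?_
    rintro _ ⟨a, ha, rfl⟩
    have hz : ∑ i, a i • x i ∈ lpComb p x := ⟨a, ha, rfl⟩
    have h1 : ∑ i, a i • (c • x) i = c • ∑ i, a i • x i := by
      rw [Finset.smul_sum]
      exact Finset.sum_congr rfl fun i _ => smul_comm _ _ _
    rw [h1]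
    refine (smul_le_abs_smul_abs _ _).trans (smul_le_smul_of_nonneg_left ?_ (abs_nonneg c))
    exact abs_le'.2 ⟨(isLUB_lpSum p x).1 hz, (isLUB_lpSum p x).1 (neg_mem_lpComb hz)⟩
  refine (norm_le_of_nonneg_le (lpSum_nonneg p _) h).trans ?_
  rw [norm_smul, Real.norm_eq_abs, abs_abs]

theorem norm_lpSum_single_le (p : ℝ≥0∞) (x : E) : ‖lpSum p (fun _ : Fin 1 => x)‖ ≤ ‖x‖ := by
  have : Fact (1 ≤ conjExp p) := ⟨one_le_conjExp p⟩
  rw [← norm_abs_eq_norm x]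
  refine norm_le_of_nonneg_le (lpSum_nonneg p _) ((isLUB_lpSum p _).2 ?_)
  rintro _ ⟨a, ha, rfl⟩
  rw [Fin.sum_univ_one]
  refine (smul_le_abs_smul_abs _ _).trans ?_
  have h1 : |a 0| ≤ 1 := (PiLp.norm_apply_le a 0).trans ha
  simpa using smul_le_smul_of_nonneg_right h1 (abs_nonneg x)

end LpSum

section Main

variable {X Y : Type*} [NormedAddCommGroup X] [NormedSpace ℝ X] [CompleteSpace X] [Lattice X]
  [IsOrderedAddMonoid X] [HasSolidNorm X] [IsOrderedModule ℝ X]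
  [NormedAddCommGroup Y] [NormedSpace ℝ Y] [CompleteSpace Y] [Lattice Y]
  [IsOrderedAddMonoid Y] [HasSolidNorm Y] [IsOrderedModule ℝ Y]

/-! ### `(p, q)`-regular operators -/

/-- `K` is a constant in the defining inequality of `(p, q)`-regularity. -/
def RegularBound (p q : ℝ≥0∞) (T : X →ₗ[ℝ] Y) (K : ℝ) : Prop :=
  ∀ (n : ℕ) (x : Fin n → X), ‖lpSum p (fun i => T (x i))‖ ≤ K * ‖lpSum q x‖

variable (X Y) in
/-- The space of `(p, q)`-regular linear maps `X → Y`. -/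
def regularOps (p q : ℝ≥0∞) : Submodule ℝ (X →ₗ[ℝ] Y) where
  carrier := {T | ∃ K : ℝ, 0 < K ∧ RegularBound p q T K}
  zero_mem' := ⟨1, one_pos, fun n x => by
    have h : ‖lpSum p (fun i => (0 : X →ₗ[ℝ] Y) (x i))‖ = 0 := norm_lpSum_zero p
    rw [h, one_mul]
    exact norm_nonneg _⟩
  add_mem' := by
    rintro S T ⟨K, hK, hS⟩ ⟨L, hL, hT⟩
    refine ⟨K + L, add_pos hK hL, fun n x => ?_⟩
    rw [add_mul]
    exact (norm_lpSum_add_le p (fun i => S (x i)) (fun i => T (x i))).trans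
      (add_le_add (hS n x) (hT n x))
  smul_mem' := by
    rintro c T ⟨K, hK, hT⟩
    refine ⟨(|c| + 1) * K, by positivity, fun n x => ?_⟩
    refine (norm_lpSum_smul_le p c (fun i => T (x i))).trans ?_
    rw [mul_assoc]
    exact mul_le_mul (by linarith) (hT n x) (norm_nonneg _) (by positivity)

/-- `ρ_{p,q}(T)`, the smallest constant in the inequality defining `(p, q)`-regularity. -/
noncomputable def regularNorm (p q : ℝ≥0∞) (T : X →ₗ[ℝ] Y) : ℝ :=
  sInf {K : ℝ | 0 ≤ K ∧ RegularBound p q T K}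

/-! ### The lattice tensor norm -/

/-- `φ_{p,q}(z)`, an infimum over all representations of `z` as a finite sum of elementary
tensors. -/
noncomputable def tensorPhi (p q : ℝ≥0∞) (z : X ⊗[ℝ] Y) : ℝ :=
  sInf {t : ℝ | ∃ (n : ℕ) (x : Fin n → X) (y : Fin n → Y), z = ∑ i, x i ⊗ₜ[ℝ] y i ∧
    t = ‖lpSum q x‖ * ‖lpSum (conjExp p) y‖}

/-- `r_{p,q}(z)`, an infimum over all decompositions of `z` as a finite sum of tensors. -/
noncomputable def tensorR (p q : ℝ≥0∞) (z : X ⊗[ℝ] Y) : ℝ :=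
  sInf {t : ℝ | ∃ (m : ℕ) (w : Fin m → X ⊗[ℝ] Y), z = ∑ j, w j ∧ t = ∑ j, tensorPhi p q (w j)}

theorem tensorPhi_le (p q : ℝ≥0∞) {z : X ⊗[ℝ] Y} {n : ℕ} (x : Fin n → X) (y : Fin n → Y)
    (hz : z = ∑ i, x i ⊗ₜ[ℝ] y i) : tensorPhi p q z ≤ ‖lpSum q x‖ * ‖lpSum (conjExp p) y‖ :=
  csInf_le ⟨0, by rintro _ ⟨n, x, y, -, rfl⟩; positivity⟩ ⟨n, x, y, hz, rfl⟩

theorem exists_tensor_repr (z : X ⊗[ℝ] Y) :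
    ∃ (n : ℕ) (x : Fin n → X) (y : Fin n → Y), z = ∑ i, x i ⊗ₜ[ℝ] y i := by
  induction z using TensorProduct.induction_on with
  | zero => exact ⟨0, 0, 0, by simp⟩
  | tmul x y => exact ⟨1, fun _ => x, fun _ => y, by simp⟩
  | add z w hz hw =>
    obtain ⟨n, x, y, rfl⟩ := hz
    obtain ⟨m, x', y', rfl⟩ := hw
    exact ⟨n + m, Fin.append x x', Fin.append y y', by simp [Fin.sum_univ_add]⟩

theorem tensorPhi_nonneg (p q : ℝ≥0∞) (z : X ⊗[ℝ] Y) : 0 ≤ tensorPhi p q z :=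
  Real.sInf_nonneg (by rintro _ ⟨n, x, y, -, rfl⟩; positivity)

theorem tensorPhi_smul_le (p q : ℝ≥0∞) (c : ℝ) (z : X ⊗[ℝ] Y) :
    tensorPhi p q (c • z) ≤ |c| * tensorPhi p q z := by
  rw [tensorPhi.eq_1 p q z, ← smul_eq_mul, ← Real.sInf_smul_of_nonneg (abs_nonneg c)]
  refine le_csInf ?_ ?_
  · obtain ⟨n, x, y, h⟩ := exists_tensor_repr z
    exact Set.Nonempty.smul_set ⟨_, n, x, y, h, rfl⟩
  · rintro _ ⟨_, ⟨n, x, y, rfl, rfl⟩, rfl⟩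
    refine (tensorPhi_le p q (c • x) y ?_).trans ?_
    · simp [Finset.smul_sum, TensorProduct.smul_tmul']
    · show _ ≤ |c| * _
      rw [← mul_assoc]
      exact mul_le_mul_of_nonneg_right (norm_lpSum_smul_le q c x) (norm_nonneg _)

theorem tensorR_bddBelow (p q : ℝ≥0∞) (z : X ⊗[ℝ] Y) :
    BddBelow {t : ℝ | ∃ (m : ℕ) (w : Fin m → X ⊗[ℝ] Y), z = ∑ j, w j ∧
      t = ∑ j, tensorPhi p q (w j)} :=
  ⟨0, by
    rintro _ ⟨m, w, -, rfl⟩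
    exact Finset.sum_nonneg fun j _ => tensorPhi_nonneg p q _⟩

theorem tensorR_le (p q : ℝ≥0∞) {z : X ⊗[ℝ] Y} {m : ℕ} (w : Fin m → X ⊗[ℝ] Y)
    (hz : z = ∑ j, w j) : tensorR p q z ≤ ∑ j, tensorPhi p q (w j) :=
  csInf_le (tensorR_bddBelow p q z) ⟨m, w, hz, rfl⟩

theorem tensorR_nonempty (p q : ℝ≥0∞) (z : X ⊗[ℝ] Y) :
    {t : ℝ | ∃ (m : ℕ) (w : Fin m → X ⊗[ℝ] Y), z = ∑ j, w j ∧
      t = ∑ j, tensorPhi p q (w j)}.Nonempty :=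
  ⟨_, 1, fun _ => z, by simp, rfl⟩

/-- `r_{p,q}` as a seminorm on `X ⊗ Y`. -/
noncomputable def tensorSeminorm (p q : ℝ≥0∞) : Seminorm ℝ (X ⊗[ℝ] Y) :=
  Seminorm.ofSMulLE (tensorR p q)
    (le_antisymm ((tensorR_le p q (m := 0) (fun _ => 0) (by simp)).trans (by simp))
      (Real.sInf_nonneg (by
        rintro _ ⟨m, w, -, rfl⟩
        exact Finset.sum_nonneg fun j _ => tensorPhi_nonneg p q _)))
    (fun z z' => by
      refine le_of_forall_pos_le_add fun ε hε => ?_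
      obtain ⟨_, ⟨m, w, hw, rfl⟩, h1⟩ :=
        exists_lt_of_csInf_lt (tensorR_nonempty p q z) (lt_add_of_pos_right _ (half_pos hε))
      obtain ⟨_, ⟨m', w', hw', rfl⟩, h2⟩ :=
        exists_lt_of_csInf_lt (tensorR_nonempty p q z') (lt_add_of_pos_right _ (half_pos hε))
      have h3 := tensorR_le p q (z := z + z') (Fin.append w w')
        (by rw [hw, hw']; simp [Fin.sum_univ_add])
      simp only [Fin.sum_univ_add, Fin.append_left, Fin.append_right] at h3
      change _ < tensorR p q z + _ at h1
      change _ < tensorR p q z' + _ at h2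
      linarith)
    (fun c z => by
      rw [tensorR.eq_1 p q z, ← smul_eq_mul, ← Real.sInf_smul_of_nonneg (norm_nonneg c)]
      refine le_csInf (tensorR_nonempty p q z).smul_set ?_
      rintro _ ⟨_, ⟨m, w, rfl, rfl⟩, rfl⟩
      refine (tensorR_le p q (fun j => c • w j) (by rw [Finset.smul_sum])).trans ?_
      show _ ≤ ‖c‖ * _
      rw [Finset.mul_sum]
      exact Finset.sum_le_sum fun j _ => tensorPhi_smul_le p q c (w j))

variable (X Y) in
/-- `X ⊗_{r_{p,q}} Y`: the algebraic tensor product, to be normed by `r_{p,q}`. -/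
def LatticeTensor (_p _q : ℝ≥0∞) : Type _ := X ⊗[ℝ] Y

noncomputable instance (p q : ℝ≥0∞) : AddCommGroup (LatticeTensor X Y p q) :=
  inferInstanceAs (AddCommGroup (X ⊗[ℝ] Y))

noncomputable instance (p q : ℝ≥0∞) : Module ℝ (LatticeTensor X Y p q) :=
  inferInstanceAs (Module ℝ (X ⊗[ℝ] Y))

noncomputable instance latticeTensorSeminormed (p q : ℝ≥0∞) :
    SeminormedAddCommGroup (LatticeTensor X Y p q) :=
  AddGroupSeminorm.toSeminormedAddCommGroup
    (tensorSeminorm (X := X) (Y := Y) p q).toAddGroupSeminorm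

noncomputable instance latticeTensorNormedSpace (p q : ℝ≥0∞) :
    NormedSpace ℝ (LatticeTensor X Y p q) where
  norm_smul_le c z := (map_smul_eq_mul (tensorSeminorm (X := X) (Y := Y) p q) c z).le

/-- The elementary tensor `x ⊗ y` as an element of `X ⊗_{r_{p,q}} Y`. -/
def latticeTmul (p q : ℝ≥0∞) (x : X) (y : Y) : LatticeTensor X Y p q := x ⊗ₜ[ℝ] y

theorem norm_latticeTmul_le (p q : ℝ≥0∞) (x : X) (y : Y) :
    ‖latticeTmul p q x y‖ ≤ ‖x‖ * ‖y‖ := by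
  have h1 : tensorR p q (x ⊗ₜ[ℝ] y) ≤ tensorPhi p q (x ⊗ₜ[ℝ] y) := by
    simpa using tensorR_le p q (fun _ : Fin 1 => x ⊗ₜ[ℝ] y) (by simp)
  have h2 := tensorPhi_le p q (z := x ⊗ₜ[ℝ] y) (fun _ : Fin 1 => x) (fun _ => y) (by simp)
  exact h1.trans (h2.trans (mul_le_mul (norm_lpSum_single_le q x)
    (norm_lpSum_single_le _ y) (norm_nonneg _) (norm_nonneg _)))

/-! ### Trace duality -/

/-- The operator `T_φ : X → Y**` attached to a bounded functional `φ` on `X ⊗_{r_{p,q}} Y*` by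
trace duality: `⟨T_φ x, y*⟩ = φ (x ⊗ y*)`. -/
noncomputable def traceOp {p q : ℝ≥0∞}
    (φ : StrongDual ℝ (LatticeTensor X (StrongDual ℝ Y) p q)) :
    X →L[ℝ] StrongDual ℝ (StrongDual ℝ Y) :=
  LinearMap.mkContinuous₂
    (LinearMap.mk₂ ℝ (fun x y' => φ (latticeTmul p q x y'))
      (fun x x' y' => by rw [← map_add]; exact congrArg φ (TensorProduct.add_tmul x x' y'))
      (fun c x y' => by rw [← map_smul]; exact congrArg φ (TensorProduct.smul_tmul' c x y').symm)
      (fun x y' z' => by rw [← map_add]; exact congrArg φ (TensorProduct.tmul_add x y' z'))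
      (fun c x y' => by rw [← map_smul]; exact congrArg φ (TensorProduct.tmul_smul c x y')))
    ‖φ‖ (fun x y' => by
      rw [mul_assoc]
      exact (φ.le_opNorm _).trans
        (mul_le_mul_of_nonneg_left (norm_latticeTmul_le p q x y') (norm_nonneg _)))

theorem traceOp_apply {p q : ℝ≥0∞} (φ : StrongDual ℝ (LatticeTensor X (StrongDual ℝ Y) p q))
    (x : X) (y' : StrongDual ℝ Y) : traceOp φ x y' = φ (latticeTmul p q x y') := rfl

variable (X Y) in
/-- `(X ⊗_{r_{p,q}} Y*)* ∩ L(X, Y)`: the bounded functionals `φ` on `X ⊗_{r_{p,q}} Y*` for which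
`T_φ : X → Y**` is a bounded operator into `Y` (followed by the canonical embedding
`Y → Y**`). -/
noncomputable def dualInterOps (p q : ℝ≥0∞) :
    Submodule ℝ (StrongDual ℝ (LatticeTensor X (StrongDual ℝ Y) p q)) where
  carrier := {φ | ∃ T : X →L[ℝ] Y, traceOp φ = (NormedSpace.inclusionInDoubleDual ℝ Y).comp T}
  zero_mem' := ⟨0, by ext x y'; simp [traceOp_apply]⟩
  add_mem' := by
    rintro φ ψ ⟨S, hS⟩ ⟨T, hT⟩
    refine ⟨S + T, ?_⟩
    rw [ContinuousLinearMap.comp_add, ← hS, ← hT]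
    rfl
  smul_mem' := by
    rintro c φ ⟨T, hT⟩
    refine ⟨c • T, ?_⟩
    rw [ContinuousLinearMap.comp_smul, ← hT]
    rfl

end Main

/-!
A linear map `T` and a tensor `∑ x i ⊗ f i` are paired to `∑ f i (T (x i))`. The identification of
`(p, q)`-regular maps with bounded functionals on `X ⊗_{r_{p,q}} Y*` amounts to the isometric
duality between the lattices `Y(ℓ_p)` and `Y*(ℓ_{p'})`, which has two halves.

* Hölder's inequality `∑ f i (y i) ≤ ‖(∑ |y i| ^ p) ^ (1 / p)‖ * ‖(∑ |f i| ^ p') ^ (1 / p')‖`,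
  in `sum_apply_le_norm_lpSum_mul`. It shows that a regularity constant of `T` bounds the pairing on
  `φ_{p,q}`, hence on `r_{p,q}`.
* Every tuple `y` has a norming tuple `f` in the unit ball of `Y*(ℓ_{p'})`, in
  `exists_norming_tuple`. Testing a functional on `∑ x i ⊗ f i`, with `f` norming `T x`, shows that
  its norm is a regularity constant.

Hölder's inequality is proved without a functional calculus or a representation of `Y` by functions.
It suffices to write `(1 - δ) y i = ∑ j, b j i • u j` with `b j` in the unit ball of `ℓ_p`,
`u j ≥ 0` and `∑ u j ≤ (∑ |y i| ^ p) ^ (1 / p)`, since then `∑ i, b j i • f i` is dominated by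
`(∑ |f i| ^ p') ^ (1 / p')` for every `j`. With the `b j` a fixed finite norming set this is a
finite system of linear inequalities for the `u j`, and Farkas' lemma holds for such systems in
every vector lattice (`exists_sum_smul_le_of_dual`), by Fourier–Motzkin elimination.

A norming tuple comes from the Hahn–Banach theorem on tuples. The bound on its norm in `Y*(ℓ_{p'})`
follows from the Riesz–Kantorovich formula for finite suprema of functionals
(`norm_lpSum_dual_le`).
-/

/-! ### Linear inequalities in vector lattices -/

section Farkas

variable {E : Type*} [AddCommGroup E] [Lattice E] [IsOrderedAddMonoid E] [Module ℝ E]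
  [IsOrderedModule ℝ E]

theorem exists_between_of_finset {F : Type*} [Lattice F] [Nonempty F] (s t : Finset F)
    (h : ∀ a ∈ s, ∀ b ∈ t, a ≤ b) : ∃ u, (∀ a ∈ s, a ≤ u) ∧ ∀ b ∈ t, u ≤ b := by
  rcases s.eq_empty_or_nonempty with rfl | hs
  · rcases t.eq_empty_or_nonempty with rfl | ht
    · exact ⟨Classical.arbitrary F, by simp, by simp⟩
    · exact ⟨t.inf' ht id, by simp, fun b hb => Finset.inf'_le id hb⟩
  · exact ⟨s.sup' hs id, fun a ha => Finset.le_sup' id ha,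
      fun b hb => Finset.sup'_le _ _ fun a ha => h a ha b hb⟩

/-- Farkas' lemma with right-hand sides in a vector lattice. Fourier–Motzkin elimination works
verbatim, as the only order property it needs is that finitely many lower bounds below finitely
many upper bounds can be separated by an element. -/
theorem exists_sum_smul_le_of_dual {ι : Type*} [Fintype ι] {k : ℕ} (A : ι → Fin k → ℝ) (b : ι → E)
    (h : ∀ c : ι → ℝ, (∀ i, 0 ≤ c i) → (∀ j, ∑ i, c i * A i j = 0) → 0 ≤ ∑ i, c i • b i) :
    ∃ u : Fin k → E, ∀ i, ∑ j, A i j • u j ≤ b i := by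
  classical
  have hs : ∀ {ι : Type _} [DecidableEq ι] (i : ι) {c : ℝ} (_ : 0 ≤ c) (j : ι),
      0 ≤ (Pi.single i c : ι → ℝ) j := by
    intro ι _ i c hc j
    rw [Pi.single_apply]
    split_ifs
    exacts [hc, le_rfl]
  induction k generalizing ι with
  | zero =>
    refine ⟨0, fun i => ?_⟩
    have := h (Pi.single i 1)
      (hs i zero_le_one) (fun j => j.elim0)
    simpa [Pi.single_apply] using this
  | succ k ih =>
    -- The rows of `M` are the nonnegative combinations of the given inequalities in which the
    -- first unknown cancels.
    let M : ι ⊕ ι × ι → ι → ℝ := Sum.elim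
      (fun i => if A i 0 = 0 then Pi.single i 1 else 0)
      (fun q => if 0 < A q.1 0 ∧ A q.2 0 < 0 then
        Pi.single q.1 (A q.1 0)⁻¹ + Pi.single q.2 (-(A q.2 0)⁻¹) else 0)
    have hM0 : ∀ r i, 0 ≤ M r i := by
      rintro (i | ⟨i, i'⟩) j
      · simp only [M, Sum.elim_inl]
        split_ifs
        · exact hs i zero_le_one j
        · simp
      · simp only [M, Sum.elim_inr]
        split_ifs with hc
        · exact add_nonneg (hs i (inv_nonneg.2 hc.1.le) j)
            (hs i' (neg_nonneg.2 (inv_nonpos.2 hc.2.le)) j)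
        · simp
    have hM : ∀ r, ∑ i, M r i * A i 0 = 0 := by
      rintro (i | ⟨i, i'⟩)
      · simp only [M, Sum.elim_inl]
        split_ifs with hc
        · simp [Pi.single_apply, hc]
        · simp
      · simp only [M, Sum.elim_inr]
        split_ifs with hc
        · simp [Pi.single_apply, add_mul, Finset.sum_add_distrib, hc.1.ne', hc.2.ne]
        · simp
    obtain ⟨u, hu⟩ := ih (fun r j => ∑ i, M r i * A i j.succ) (fun r => ∑ i, M r i • b i) (by
      intro c hc hcA
      have h1 := h (fun i => ∑ r, c r * M r i)
        (fun i => Finset.sum_nonneg fun r _ => mul_nonneg (hc r) (hM0 r i)) (by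
          have key : ∀ j, ∑ i, (∑ r, c r * M r i) * A i j = ∑ r, c r * ∑ i, M r i * A i j := by
            intro j
            simp only [Finset.sum_mul, Finset.mul_sum]
            rw [Finset.sum_comm]
            simp only [mul_assoc]
          intro j
          rw [key]
          refine Fin.cases ?_ (fun j => ?_) j
          · simp [hM]
          · exact hcA j)
      simp only [Finset.sum_smul, Finset.smul_sum, mul_smul] at h1 ⊢
      rwa [Finset.sum_comm])
    -- With the other unknowns `u` fixed, the inequality `i` reads `A i 0 • v ≤ R i`. It bounds the
    -- first unknown `v` above, below or not at all, according to the sign of `A i 0`.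
    let R : ι → E := fun i => b i - ∑ j, A i j.succ • u j
    have hR : ∀ r, 0 ≤ ∑ i, M r i • R i := by
      intro r
      have h1 := hu r
      simp only [R, smul_sub, Finset.sum_sub_distrib, sub_nonneg]
      simp only [Finset.sum_smul, Finset.smul_sum, mul_smul] at h1 ⊢
      rwa [Finset.sum_comm]
    obtain ⟨v, hv1, hv2⟩ := exists_between_of_finset
      ((Finset.univ.filter fun i => A i 0 < 0).image fun i => (A i 0)⁻¹ • R i)
      ((Finset.univ.filter fun i => 0 < A i 0).image fun i => (A i 0)⁻¹ • R i) (by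
        simp only [Finset.mem_image, Finset.mem_filter, Finset.mem_univ, true_and]
        rintro _ ⟨i, hi, rfl⟩ _ ⟨i', hi', rfl⟩
        have h1 := hR (Sum.inr (i', i))
        simp only [M, Sum.elim_inr, hi, hi', and_self, if_true, Pi.add_apply, add_smul,
          Finset.sum_add_distrib, Pi.single_apply, ite_smul, zero_smul, Finset.sum_ite_eq',
          Finset.mem_univ, neg_smul] at h1
        rwa [← sub_eq_add_neg, sub_nonneg] at h1)
    refine ⟨Fin.cons v u, fun i => ?_⟩
    rw [Fin.sum_univ_succ]
    simp only [Fin.cons_zero, Fin.cons_succ]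
    rw [← le_sub_iff_add_le]
    change A i 0 • v ≤ R i
    rcases lt_trichotomy (A i 0) 0 with hi | hi | hi
    · have h1 := hv1 _ (Finset.mem_image_of_mem _ (Finset.mem_filter.2 ⟨Finset.mem_univ i, hi⟩))
      have h2 := smul_le_smul_of_nonneg_left h1 (neg_pos.2 hi).le
      rw [neg_smul, neg_smul, smul_smul, mul_inv_cancel₀ hi.ne, one_smul] at h2
      exact neg_le_neg_iff.1 h2
    · have h1 := hR (Sum.inl i)
      simp only [M, Sum.elim_inl, hi, if_true, Pi.single_apply, ite_smul, zero_smul,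
        Finset.sum_ite_eq', Finset.mem_univ, one_smul] at h1
      rwa [hi, zero_smul]
    · have h1 := hv2 _ (Finset.mem_image_of_mem _ (Finset.mem_filter.2 ⟨Finset.mem_univ i, hi⟩))
      have h2 := smul_le_smul_of_nonneg_left h1 hi.le
      rwa [smul_smul, mul_inv_cancel₀ hi.ne', one_smul] at h2

end Farkas

/-! ### Duality of finite-dimensional `ℓ_p` spaces -/

section FiniteLp

variable {ι : Type*} [Fintype ι] {r s : ℝ≥0∞}

theorem holderConjugate_cases (r s : ℝ≥0∞) [h : r.HolderConjugate s] :
    (r = ∞ ∧ s = 1) ∨ (r = 1 ∧ s = ∞) ∨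
      (0 < r.toReal ∧ 0 < s.toReal ∧ r.toReal.HolderConjugate s.toReal) := by
  have hi := ENNReal.HolderConjugate.inv_add_inv_eq_one r s
  by_cases hr : r = ∞
  · left
    subst hr
    simp at hi
    exact ⟨rfl, hi⟩
  by_cases hs : s = ∞
  · right; left
    subst hs
    simp at hi
    exact ⟨hi, rfl⟩
  have := ENNReal.HolderConjugate.toReal_of_ne_top hr hs
  exact Or.inr (Or.inr ⟨this.pos, this.symm.pos, this⟩)

theorem PiLp.sum_mul_le_norm_mul_norm [h : r.HolderConjugate s]
    (a : PiLp r fun _ : ι => ℝ) (b : PiLp s fun _ : ι => ℝ) : ∑ i, a i * b i ≤ ‖a‖ * ‖b‖ := by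
  have key : ∀ (a : PiLp ∞ fun _ : ι => ℝ) (b : PiLp 1 fun _ : ι => ℝ),
      ∑ i, a i * b i ≤ ‖a‖ * ‖b‖ := by
    intro a b
    rw [PiLp.norm_eq_of_L1, Finset.mul_sum]
    refine Finset.sum_le_sum fun i _ => (le_abs_self _).trans ?_
    rw [abs_mul]
    exact mul_le_mul_of_nonneg_right (PiLp.norm_apply_le a i) (abs_nonneg _)
  rcases holderConjugate_cases r s with ⟨rfl, rfl⟩ | ⟨rfl, rfl⟩ | ⟨hr, hs, hc⟩
  · exact key a b
  · rw [mul_comm]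
    simpa only [mul_comm] using key b a
  · rw [PiLp.norm_eq_sum hr, PiLp.norm_eq_sum hs]
    exact Real.inner_le_Lp_mul_Lq _ _ _ hc

theorem PiLp.exists_norm_le_sum_mul [h : r.HolderConjugate s] (a : PiLp r fun _ : ι => ℝ) :
    ∃ b : PiLp s fun _ : ι => ℝ, ‖b‖ ≤ 1 ∧ ‖a‖ ≤ ∑ i, a i * b i := by
  classical
  rcases holderConjugate_cases r s with ⟨rfl, rfl⟩ | ⟨rfl, rfl⟩ | ⟨hr, hs, hc⟩
  · rcases isEmpty_or_nonempty ι with hι | hι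
    · exact ⟨0, by simp, by simp [PiLp.norm_eq_ciSup]⟩
    · obtain ⟨i, hi⟩ := Finite.exists_max fun i => ‖a i‖
      refine ⟨WithLp.toLp 1 (Pi.single i (SignType.sign (a i) : ℝ)), ?_, ?_⟩
      · rw [PiLp.norm_eq_of_L1, Finset.sum_eq_single i]
        · rcases lt_trichotomy (a i) 0 with h | h | h <;> simp [h]
        · intro j _ hj
          simp [Pi.single_eq_of_ne hj]
        · simp
      · rw [PiLp.norm_eq_ciSup]
        refine ciSup_le fun j => (hi j).trans ?_
        simp [Pi.single_apply, self_mul_sign]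
  · refine ⟨WithLp.toLp ∞ fun i => (SignType.sign (a i) : ℝ), ?_, ?_⟩
    · rw [PiLp.norm_eq_ciSup]
      refine Real.iSup_le (fun i => ?_) zero_le_one
      rcases lt_trichotomy (a i) 0 with h | h | h <;> simp [h]
    · rw [PiLp.norm_eq_of_L1]
      simp [self_mul_sign]
  · obtain ⟨g, hg, hge⟩ := (NNReal.isGreatest_Lp Finset.univ (fun i => ‖a i‖₊) hc).1
    refine ⟨WithLp.toLp s fun i => (SignType.sign (a i) : ℝ) * g i, ?_, ?_⟩
    · rw [PiLp.norm_eq_sum hs]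
      refine Real.rpow_le_one (by positivity) ?_ (by positivity)
      have h1 : ∑ i, (g i : ℝ) ^ s.toReal ≤ 1 := by exact_mod_cast hg
      refine le_trans (Finset.sum_le_sum fun i _ => ?_) h1
      refine Real.rpow_le_rpow (norm_nonneg _) ?_ hs.le
      rcases lt_trichotomy (a i) 0 with h | h | h <;> simp [h]
    · have h2 : ‖a‖ = ∑ i, ‖a i‖ * g i := by
        rw [PiLp.norm_eq_sum hr]
        have := congrArg NNReal.toReal hge
        push_cast at this
        exact this.symm
      rw [h2]
      refine le_of_eq (Finset.sum_congr rfl fun i _ => ?_)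
      simp only
      rw [← mul_assoc, self_mul_sign, Real.norm_eq_abs]

theorem PiLp.exists_finite_net (s : ℝ≥0∞) [Fact (1 ≤ s)] {δ : ℝ} (hδ : 0 < δ) :
    ∃ (m : ℕ) (b : Fin m → PiLp s fun _ : ι => ℝ), (∀ j, ‖b j‖ ≤ 1) ∧
      ∀ a : PiLp s fun _ : ι => ℝ, ‖a‖ ≤ 1 → ∃ j, ‖a - b j‖ ≤ δ := by
  have hc : IsCompact (Metric.closedBall (0 : PiLp s (fun _ : ι => ℝ)) 1) :=
    isCompact_closedBall _ _
  obtain ⟨t, htB, htf, ht⟩ := Metric.finite_approx_of_totallyBounded hc.totallyBounded δ hδ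
  let e := htf.toFinset.equivFin
  refine ⟨_, fun j => e.symm j, fun j => ?_, fun a ha => ?_⟩
  · simpa using htB (htf.mem_toFinset.1 (e.symm j).2)
  · obtain ⟨b, hb, hab⟩ := Set.mem_iUnion₂.1 (ht (by simpa using ha : a ∈ Metric.closedBall 0 1))
    refine ⟨e ⟨b, htf.mem_toFinset.2 hb⟩, ?_⟩
    rw [Metric.mem_ball, dist_eq_norm] at hab
    simpa using hab.le

/-- Up to the factor `1 - δ`, finitely many points of the unit ball norm the conjugate space. -/
theorem PiLp.exists_finite_norming (r s : ℝ≥0∞) [h : r.HolderConjugate s] [Fact (1 ≤ r)]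
    [Fact (1 ≤ s)] {δ : ℝ} (hδ : 0 < δ) :
    ∃ (m : ℕ) (b : Fin m → PiLp s fun _ : ι => ℝ), (∀ j, ‖b j‖ ≤ 1) ∧
      ∀ (a : PiLp r fun _ : ι => ℝ) (μ : ℝ), (∀ j, ∑ i, a i * b j i ≤ μ) →
        (1 - δ) * ‖a‖ ≤ μ := by
  obtain ⟨m, b, hb, hbδ⟩ := PiLp.exists_finite_net (ι := ι) s hδ
  refine ⟨m, b, hb, fun a μ hμ => ?_⟩
  obtain ⟨c, hc, hac⟩ := PiLp.exists_norm_le_sum_mul (s := s) a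
  obtain ⟨j, hj⟩ := hbδ c hc
  have h1 := hμ j
  have h2 := PiLp.sum_mul_le_norm_mul_norm a (c - b j)
  have h3 : ∑ i, a i * (c - b j) i = ∑ i, a i * c i - ∑ i, a i * b j i := by
    simp [mul_sub, Finset.sum_sub_distrib]
  have h4 := mul_le_mul_of_nonneg_left hj (norm_nonneg a)
  linarith

/-- The coefficients for the dual sum `(∑ |f i| ^ p') ^ (1 / p')` have exponent
`conjExp (conjExp p)`. It is conjugate to `conjExp p` for every `p`, whereas it equals `p` only for
`1 ≤ p`. -/
theorem holderConjugate_conjExp (p : ℝ≥0∞) :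
    (conjExp p).HolderConjugate (conjExp (conjExp p)) :=
  ENNReal.HolderConjugate.inv_one_sub_inv' (one_le_conjExp p)

end FiniteLp

/-! ### Hölder's inequality in a Banach lattice -/

section Holder

variable {E : Type*} [NormedAddCommGroup E] [NormedSpace ℝ E] [Lattice E] [IsOrderedAddMonoid E]
  [HasSolidNorm E] [IsOrderedModule ℝ E] [CompleteSpace E]

theorem sum_smul_le_norm_smul_lpSum (p : ℝ≥0∞) {n : ℕ} (y : Fin n → E)
    (a : PiLp (conjExp p) fun _ : Fin n => ℝ) : ∑ i, a i • y i ≤ ‖a‖ • lpSum p y := by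
  have : Fact (1 ≤ conjExp p) := ⟨one_le_conjExp p⟩
  rcases eq_or_ne a 0 with rfl | ha
  · simp
  have h0 : 0 < ‖a‖ := norm_pos_iff.2 ha
  have h1 : ∑ i, (‖a‖⁻¹ • a) i • y i ≤ lpSum p y :=
    (isLUB_lpSum p y).1 ⟨‖a‖⁻¹ • a, by rw [norm_smul, norm_inv, norm_norm,
      inv_mul_cancel₀ h0.ne'], rfl⟩
  have h2 := smul_le_smul_of_nonneg_left h1 h0.le
  have h3 : ∑ i, (‖a‖⁻¹ • a) i • y i = ‖a‖⁻¹ • ∑ i, a i • y i := by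
    rw [Finset.smul_sum]
    exact Finset.sum_congr rfl fun i _ => mul_smul _ _ _
  rwa [h3, smul_inv_smul₀ h0.ne'] at h2

/-- A substitute for the approximation by simple functions that is available when `E` is a function
lattice: up to the factor `1 - δ`, a tuple `y` is a combination of finitely many
coefficient vectors from the unit ball of `ℓ_p`, with weights from the positive cone of `E` whose
sum is at most `(∑ |y i| ^ p) ^ (1 / p)`. The dual condition in Farkas' lemma is the
definition of `(∑ |y i| ^ p) ^ (1 / p)` as a least upper bound. -/
theorem exists_positive_decomposition (p : ℝ≥0∞) {n : ℕ} (y : Fin n → E) {δ : ℝ} (hδ : 0 < δ)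
    (hδ1 : δ ≤ 1) :
    ∃ (m : ℕ) (b : Fin m → PiLp (conjExp (conjExp p)) fun _ : Fin n => ℝ) (u : Fin m → E),
      (∀ j, ‖b j‖ ≤ 1) ∧ (∀ j, 0 ≤ u j) ∧ ∑ j, u j ≤ lpSum p y ∧
        ∀ i, ∑ j, b j i • u j = (1 - δ) • y i := by
  classical
  have : Fact (1 ≤ conjExp p) := ⟨one_le_conjExp p⟩
  have : Fact (1 ≤ conjExp (conjExp p)) := ⟨one_le_conjExp _⟩
  have := holderConjugate_conjExp p
  obtain ⟨m, b, hb, hba⟩ :=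
    PiLp.exists_finite_norming (ι := Fin n) (conjExp p) (conjExp (conjExp p)) hδ
  -- The system says `0 ≤ u j`, `∑ j, b j i • u j = (1 - δ) • y i` as two inequalities, and
  -- `∑ j, u j ≤ lpSum p y`.
  obtain ⟨u, hu⟩ := exists_sum_smul_le_of_dual (ι := Fin m ⊕ (Fin n ⊕ Fin n) ⊕ Unit) (k := m)
    (Sum.elim (fun k j => if j = k then -1 else 0)
      (Sum.elim (Sum.elim (fun i j => b j i) (fun i j => -b j i)) fun _ _ => 1))
    (Sum.elim (fun _ => 0) (Sum.elim
      (Sum.elim (fun i => (1 - δ) • y i) (fun i => -((1 - δ) • y i))) fun _ => lpSum p y)) (by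
    intro c hc hcA
    simp only [Fintype.sum_sum_type, Sum.elim_inl, Sum.elim_inr, smul_zero,
      Finset.sum_const_zero, zero_add, Finset.univ_unique, Finset.sum_singleton, mul_ite, mul_neg,
      mul_one, mul_zero, Finset.sum_ite_eq, Finset.mem_univ, if_true, smul_neg,
      Finset.sum_neg_distrib] at hcA ⊢
    -- The multipliers of the two halves of the equations enter only through their difference `a`,
    -- and the dual constraints bound `∑ i, a i * b j i` by the multiplier of the last inequality.
    let a : PiLp (conjExp p) fun _ : Fin n => ℝ :=
      WithLp.toLp _ fun i => c (.inr (.inl (.inr i))) - c (.inr (.inl (.inl i)))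
    have h1 := hba a (c (.inr (.inr default))) fun j => by
      have h2 := hcA j
      have h3 := hc (.inl j)
      simp only [a, sub_mul, Finset.sum_sub_distrib]
      linarith
    have h2 := smul_le_smul_of_nonneg_right h1 (lpSum_nonneg p y)
    have h3 := smul_le_smul_of_nonneg_left (sum_smul_le_norm_smul_lpSum p y a)
      (sub_nonneg.2 hδ1)
    rw [smul_smul] at h3
    have h4 := h3.trans h2
    have h5 : ∑ i, a i • y i = ∑ i, c (.inr (.inl (.inr i))) • y i -
        ∑ i, c (.inr (.inl (.inl i))) • y i := by
      simp only [a, sub_smul, Finset.sum_sub_distrib]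
    rw [h5, smul_sub, ← sub_nonneg] at h4
    simp only [smul_comm _ (1 - δ), ← Finset.smul_sum]
    convert! h4 using 1
    abel)
  simp only [Sum.forall, Sum.elim_inl, Sum.elim_inr, ite_smul, neg_smul, one_smul, zero_smul,
    Finset.sum_ite_eq', Finset.mem_univ, if_true, Finset.sum_neg_distrib, neg_le_neg_iff,
    neg_nonpos] at hu
  exact ⟨m, b, u, hb, hu.1, hu.2.2 (), fun i => le_antisymm (hu.2.1.1 i) (hu.2.1.2 i)⟩

theorem sum_apply_le_norm_lpSum_mul (p : ℝ≥0∞) {n : ℕ} (y : Fin n → E)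
    (f : Fin n → StrongDual ℝ E) :
    ∑ i, f i (y i) ≤ ‖lpSum p y‖ * ‖lpSum (conjExp p) f‖ := by
  set S := ∑ i, f i (y i)
  set R := ‖lpSum p y‖ * ‖lpSum (conjExp p) f‖
  have hR : 0 ≤ R := by positivity
  have key : ∀ δ : ℝ, 0 < δ → δ ≤ 1 → (1 - δ) * S ≤ R := by
    intro δ hδ hδ1
    obtain ⟨m, b, u, hb, hu, hs, he⟩ := exists_positive_decomposition p y hδ hδ1
    have h1 : (1 - δ) * S = ∑ j, (∑ i, b j i • f i) (u j) := by
      calc (1 - δ) * S = ∑ i, f i (∑ j, b j i • u j) := by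
            simp only [he, S, map_smul, Finset.mul_sum, smul_eq_mul]
        _ = ∑ i, ∑ j, b j i * f i (u j) := by simp only [map_sum, map_smul, smul_eq_mul]
        _ = _ := by
            rw [Finset.sum_comm]
            simp
    rw [h1]
    calc ∑ j, (∑ i, b j i • f i) (u j) ≤ ∑ j, lpSum (conjExp p) f (u j) :=
          Finset.sum_le_sum fun j _ =>
            (isLUB_lpSum (conjExp p) f).1 ⟨b j, hb j, rfl⟩ (u j) (hu j)
      _ = lpSum (conjExp p) f (∑ j, u j) := (map_sum _ _ _).symm
      _ ≤ lpSum (conjExp p) f (lpSum p y) := by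
          have := lpSum_nonneg (conjExp p) f _ (sub_nonneg.2 hs)
          rw [_root_.zero_apply, map_sub] at this
          linarith
      _ ≤ R := by
          refine (le_abs_self _).trans (((lpSum (conjExp p) f).le_opNorm _).trans_eq ?_)
          exact mul_comm _ _
  -- If `R < S`, this `δ` gives `(1 - δ) * S = (S + R) / 2 > R`.
  by_contra! hlt
  have hS : 0 < S := hR.trans_lt hlt
  have h2 := key ((S - R) / (2 * S)) (div_pos (sub_pos.2 hlt) (by positivity))
    ((div_le_one (by positivity)).2 (by linarith))
  have h3 : (1 - (S - R) / (2 * S)) * S = (S + R) / 2 := by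
    field_simp
    ring
  linarith

end Holder

/-! ### Norming functionals -/

section Norming

variable {E : Type*} [NormedAddCommGroup E] [NormedSpace ℝ E] [Lattice E] [IsOrderedAddMonoid E]
  [HasSolidNorm E]

theorem dual_sup_apply_le {f g : StrongDual ℝ E} {x : E} (hx : 0 ≤ x) {c : ℝ}
    (h : ∀ w, 0 ≤ w → w ≤ x → f w + g (x - w) ≤ c) : (f ⊔ g) x ≤ c := by
  change (g + dualPos (f - g)) x ≤ c
  rw [_root_.add_apply, dualPos_apply _ hx, ← le_sub_iff_add_le']
  refine csSup_le ((Set.nonempty_Icc.2 hx).image _) ?_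
  rintro _ ⟨w, hw, rfl⟩
  have := h w hw.1 hw.2
  rw [map_sub] at this
  rw [_root_.sub_apply]
  linarith

/-- One half of the Riesz–Kantorovich formula for the supremum of finitely many functionals. -/
theorem dual_finset_sup'_apply_le {κ : Type*} {F : Finset κ} (hF : F.Nonempty)
    (g : κ → StrongDual ℝ E) {x : E} (hx : 0 ≤ x) {c : ℝ}
    (h : ∀ u : κ → E, (∀ j, 0 ≤ u j) → ∑ j ∈ F, u j = x → ∑ j ∈ F, g j (u j) ≤ c) :
    F.sup' hF g x ≤ c := by
  classical
  induction hF using Finset.Nonempty.cons_induction generalizing x c with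
  | singleton a =>
    simpa using h (fun _ => x) (fun _ => hx) (by simp)
  | cons a s ha hs ih =>
    rw [Finset.sup'_cons hs]
    refine dual_sup_apply_le hx fun w hw hwx => ?_
    rw [← le_sub_iff_add_le']
    refine ih (sub_nonneg.2 hwx) fun u hu hux => ?_
    have hne : ∀ j ∈ s, j ≠ a := fun j hj hja => ha (hja ▸ hj)
    have h1 := h (Function.update u a w)
      (fun j => by
        rcases eq_or_ne j a with rfl | hj
        · simpa using hw
        · simpa [Function.update_of_ne hj] using hu j)
      (by
        rw [Finset.sum_cons, Function.update_self,
          Finset.sum_congr rfl fun j hj => Function.update_of_ne (hne j hj) w u, hux]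
        abel)
    rw [Finset.sum_cons, Function.update_self, Finset.sum_congr rfl fun j hj => by
      rw [Function.update_of_ne (hne j hj) w u]] at h1
    linarith

theorem opNorm_le_of_nonneg_apply_le {f : StrongDual ℝ E} (hf : 0 ≤ f) {C : ℝ} (hC : 0 ≤ C)
    (h : ∀ x, 0 ≤ x → f x ≤ C * ‖x‖) : ‖f‖ ≤ C := by
  refine f.opNorm_le_bound hC fun x => ?_
  have h1 : ∀ z : E, 0 ≤ z → 0 ≤ f z := fun z hz => hf z hz
  have h2 := h |x| (abs_nonneg x)
  rw [norm_abs_eq_norm] at h2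
  have h3 := h1 _ (sub_nonneg.2 (le_abs_self x))
  have h4 := h1 _ (sub_nonneg.2 (neg_le_abs x))
  rw [map_sub] at h3 h4
  rw [map_neg] at h4
  exact abs_le.2 ⟨by linarith, by linarith⟩

variable [IsOrderedModule ℝ E] [CompleteSpace E]

/-- The converse of `norm_lpSum_single_le`; it makes regular maps bounded. -/
theorem norm_le_norm_lpSum_single (p : ℝ≥0∞) (x : E) : ‖x‖ ≤ ‖lpSum p (fun _ : Fin 1 => x)‖ := by
  have : Fact (1 ≤ conjExp p) := ⟨one_le_conjExp p⟩
  have hx : x ∈ lpComb p (fun _ : Fin 1 => x) :=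
    ⟨PiLp.single (conjExp p) 0 1, by rw [PiLp.norm_single]; simp, by simp⟩
  apply norm_le_norm_of_abs_le_abs
  rw [abs_of_nonneg (lpSum_nonneg p _)]
  exact abs_le'.2 ⟨(isLUB_lpSum p _).1 hx, (isLUB_lpSum p _).1 (neg_mem_lpComb hx)⟩

/-- A tuple of functionals whose joint pairing is bounded on the lattice `E(ℓ_p)` has norm at most
that bound in `E*(ℓ_{p'})`. -/
theorem norm_lpSum_dual_le (p : ℝ≥0∞) {n : ℕ} (f : Fin n → StrongDual ℝ E) {C : ℝ} (hC : 0 ≤ C)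
    (h : ∀ z : Fin n → E, ∑ i, f i (z i) ≤ C * ‖lpSum p z‖) : ‖lpSum (conjExp p) f‖ ≤ C := by
  have : Fact (1 ≤ conjExp p) := ⟨one_le_conjExp p⟩
  have : Fact (1 ≤ conjExp (conjExp p)) := ⟨one_le_conjExp _⟩
  have := holderConjugate_conjExp p
  refine opNorm_le_of_nonneg_apply_le (lpSum_nonneg _ _) hC fun x hx => ?_
  refine le_of_forall_pos_le_add fun ε hε => ?_
  have he : 0 ≤ (∑ i, |f i|) x :=
    (Finset.sum_nonneg fun i _ => abs_nonneg (f i) : 0 ≤ ∑ i, |f i|) x hx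
  have hδ : 0 < ε / ((∑ i, |f i|) x + 1) := by positivity
  set δ := ε / ((∑ i, |f i|) x + 1) with hδdef
  obtain ⟨m, b, hb, hbδ⟩ := PiLp.exists_finite_net (ι := Fin n) (conjExp (conjExp p)) hδ
  have hne : (Finset.univ : Finset (Fin m)).Nonempty := by
    obtain ⟨j, -⟩ := hbδ 0 (by simp)
    exact ⟨j, Finset.mem_univ j⟩
  -- The least upper bound is approximated by a supremum of finitely many functionals, for which
  -- the Riesz–Kantorovich formula is available.
  have h1 : lpSum (conjExp p) f ≤
      Finset.univ.sup' hne (fun j => ∑ i, b j i • f i) + δ • ∑ i, |f i| := by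
    refine (isLUB_lpSum _ f).2 ?_
    rintro _ ⟨a, ha, rfl⟩
    obtain ⟨j, hj⟩ := hbδ a ha
    refine le_trans ?_ (add_le_add (Finset.le_sup' (fun j => ∑ i, b j i • f i)
      (Finset.mem_univ j)) le_rfl)
    rw [← sub_le_iff_le_add', ← Finset.sum_sub_distrib, Finset.smul_sum]
    refine Finset.sum_le_sum fun i _ => ?_
    rw [← sub_smul]
    exact (smul_le_abs_smul_abs _ _).trans (smul_le_smul_of_nonneg_right
      ((PiLp.norm_apply_le (a - b j) i).trans hj) (abs_nonneg _))
  have h2 : Finset.univ.sup' hne (fun j => ∑ i, b j i • f i) x ≤ C * ‖x‖ := by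
    refine dual_finset_sup'_apply_le hne _ hx fun u hu hux => ?_
    have h3 : ∑ j, (∑ i, b j i • f i) (u j) = ∑ i, f i (∑ j, b j i • u j) := by
      simp only [map_sum, map_smul, _root_.sum_apply]
      rw [Finset.sum_comm]
      rfl
    rw [h3]
    refine (h _).trans (mul_le_mul_of_nonneg_left ?_ hC)
    -- By scalar Hölder, the tuple `∑ j, b j i • u j` has `ℓ_p` sum at most `∑ j, u j = x`.
    refine norm_le_of_nonneg_le (lpSum_nonneg p _) ((isLUB_lpSum p _).2 ?_)
    rintro _ ⟨a, ha, rfl⟩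
    calc ∑ i, a i • ∑ j, b j i • u j = ∑ j, (∑ i, a i * b j i) • u j := by
          simp only [Finset.smul_sum, Finset.sum_smul, smul_smul]
          exact Finset.sum_comm
      _ ≤ ∑ j, (1 : ℝ) • u j := by
          refine Finset.sum_le_sum fun j _ => smul_le_smul_of_nonneg_right ?_ (hu j)
          exact (PiLp.sum_mul_le_norm_mul_norm a (b j)).trans
            (mul_le_one₀ ha (norm_nonneg _) (hb j))
      _ = x := by simpa using hux
  have h4 := h1 x hx
  rw [_root_.add_apply, _root_.smul_apply, smul_eq_mul] at h4
  have h5 : δ * (∑ i, |f i|) x ≤ ε := by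
    rw [hδdef, div_mul_eq_mul_div, div_le_iff₀ (by positivity)]
    nlinarith
  linarith

theorem norm_lpSum_smul_of_pos (p : ℝ≥0∞) {n : ℕ} {c : ℝ} (hc : 0 < c) (y : Fin n → E) :
    ‖lpSum p (c • y)‖ = c * ‖lpSum p y‖ := by
  refine le_antisymm ((norm_lpSum_smul_le p c y).trans_eq (by rw [abs_of_pos hc])) ?_
  have h := norm_lpSum_smul_le p c⁻¹ (c • y)
  rw [smul_smul, inv_mul_cancel₀ hc.ne', one_smul, abs_of_pos (inv_pos.2 hc)] at h
  exact (le_inv_mul_iff₀ hc).1 h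

/-- Hahn–Banach for the norm `‖(∑ |y i| ^ p) ^ (1 / p)‖` on tuples. -/
theorem exists_norming_tuple (p : ℝ≥0∞) {n : ℕ} (y : Fin n → E) :
    ∃ f : Fin n → StrongDual ℝ E, ‖lpSum (conjExp p) f‖ ≤ 1 ∧
      ∑ i, f i (y i) = ‖lpSum p y‖ := by
  classical
  rcases eq_or_ne y 0 with rfl | hy
  · exact ⟨0, by rw [norm_lpSum_zero]; exact zero_le_one, by simp [norm_lpSum_zero]⟩
  obtain ⟨g, hgy, hg⟩ := exists_extension_of_le_sublinear
    (LinearPMap.mkSpanSingleton (K := ℝ) y ‖lpSum p y‖ hy)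
    (fun z => ‖lpSum p z‖) (fun c hc z => norm_lpSum_smul_of_pos p hc z)
    (fun z w => norm_lpSum_add_le p z w) (by
      rintro ⟨z, hz⟩
      obtain ⟨c, rfl⟩ := Submodule.mem_span_singleton.1 hz
      refine (LinearPMap.mkSpanSingleton'_apply y ‖lpSum p y‖ _ c hz).trans_le ?_
      rw [smul_eq_mul]
      rcases le_or_gt c 0 with hc | hc
      · exact (mul_nonpos_of_nonpos_of_nonneg hc (norm_nonneg _)).trans (norm_nonneg _)
      · exact (norm_lpSum_smul_of_pos p hc y).ge)
  have hs : ∀ i x, ‖lpSum p (Pi.single i x : Fin n → E)‖ ≤ ‖x‖ := by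
    have : Fact (1 ≤ conjExp p) := ⟨one_le_conjExp p⟩
    intro i x
    rw [← norm_abs_eq_norm x]
    refine norm_le_of_nonneg_le (lpSum_nonneg p _) ((isLUB_lpSum p _).2 ?_)
    rintro _ ⟨a, ha, rfl⟩
    rw [Finset.sum_eq_single i (fun j _ hj => by rw [Pi.single_eq_of_ne hj, smul_zero])
      (by simp), Pi.single_eq_same]
    refine (smul_le_abs_smul_abs _ _).trans ?_
    have h1 : |a i| ≤ 1 := (PiLp.norm_apply_le a i).trans ha
    simpa using smul_le_smul_of_nonneg_right h1 (abs_nonneg x)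
  let f : Fin n → StrongDual ℝ E := fun i =>
    (g ∘ₗ LinearMap.single ℝ (fun _ => E) i).mkContinuous 1 fun x => by
      rw [one_mul, Real.norm_eq_abs]
      refine abs_le'.2 ⟨(hg _).trans (hs i x), ?_⟩
      rw [← map_neg]
      exact (hg _).trans ((hs i (-x)).trans_eq (norm_neg x))
  have hf : ∀ z : Fin n → E, ∑ i, f i (z i) = g z := by
    intro z
    conv_rhs => rw [← Finset.univ_sum_single z, map_sum]
    rfl
  refine ⟨f, norm_lpSum_dual_le p f zero_le_one fun z => ?_, ?_⟩
  · rw [hf, one_mul]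
    exact hg z
  · have := hgy ⟨y, Submodule.mem_span_singleton_self y⟩
    rw [hf, this]
    exact LinearPMap.mkSpanSingleton_apply ℝ ℝ hy ‖lpSum p y‖

end Norming

/-! ### Regular operators as functionals on the tensor product -/

section Main

variable {X Y : Type*} [NormedAddCommGroup X] [NormedSpace ℝ X] [CompleteSpace X] [Lattice X]
  [IsOrderedAddMonoid X] [HasSolidNorm X] [IsOrderedModule ℝ X]
  [NormedAddCommGroup Y] [NormedSpace ℝ Y] [CompleteSpace Y] [Lattice Y]
  [IsOrderedAddMonoid Y] [HasSolidNorm Y] [IsOrderedModule ℝ Y]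

variable (X Y) in
/-- Trace duality: the functional `x ⊗ y* ↦ ⟨T x, y*⟩` attached to a linear map `T`. -/
noncomputable def tracePairing : (X →ₗ[ℝ] Y) →ₗ[ℝ] (X ⊗[ℝ] StrongDual ℝ Y →ₗ[ℝ] ℝ) where
  toFun T := TensorProduct.lift (LinearMap.mk₂ ℝ (fun x f => f (T x))
    (fun x x' f => by simp) (fun c x f => by simp) (fun x f g => by simp) (fun c x f => by simp))
  map_add' S T := TensorProduct.ext' fun x f => by simp
  map_smul' c T := TensorProduct.ext' fun x f => by simp

@[simp]
theorem tracePairing_tmul (T : X →ₗ[ℝ] Y) (x : X) (f : StrongDual ℝ Y) :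
    tracePairing X Y T (x ⊗ₜ f) = f (T x) := rfl

theorem tracePairing_le_mul_tensorPhi {p q : ℝ≥0∞} {T : X →ₗ[ℝ] Y} {K : ℝ} (hK : 0 ≤ K)
    (hT : RegularBound p q T K) (z : X ⊗[ℝ] StrongDual ℝ Y) :
    tracePairing X Y T z ≤ K * tensorPhi p q z := by
  rw [tensorPhi, ← smul_eq_mul, ← Real.sInf_smul_of_nonneg hK]
  refine le_csInf ?_ ?_
  · obtain ⟨n, x, y, h⟩ := exists_tensor_repr z
    exact Set.Nonempty.smul_set ⟨_, n, x, y, h, rfl⟩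
  · rintro _ ⟨_, ⟨n, x, f, rfl, rfl⟩, rfl⟩
    simp only [map_sum, tracePairing_tmul, smul_eq_mul]
    rw [← mul_assoc]
    exact (sum_apply_le_norm_lpSum_mul p (fun i => T (x i)) f).trans
      (mul_le_mul_of_nonneg_right (hT n x) (norm_nonneg _))

theorem tracePairing_le_mul_tensorR {p q : ℝ≥0∞} {T : X →ₗ[ℝ] Y} {K : ℝ} (hK : 0 ≤ K)
    (hT : RegularBound p q T K) (z : X ⊗[ℝ] StrongDual ℝ Y) :
    tracePairing X Y T z ≤ K * tensorR p q z := by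
  rw [tensorR, ← smul_eq_mul, ← Real.sInf_smul_of_nonneg hK]
  refine le_csInf (tensorR_nonempty p q z).smul_set ?_
  rintro _ ⟨_, ⟨m, w, rfl, rfl⟩, rfl⟩
  simp only [map_sum, smul_eq_mul, Finset.mul_sum]
  exact Finset.sum_le_sum fun j _ => tracePairing_le_mul_tensorPhi hK hT (w j)

theorem abs_tracePairing_le {p q : ℝ≥0∞} {T : X →ₗ[ℝ] Y} {K : ℝ} (hK : 0 ≤ K)
    (hT : RegularBound p q T K) (z : LatticeTensor X (StrongDual ℝ Y) p q) :
    ‖tracePairing X Y T z‖ ≤ K * ‖z‖ := by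
  refine abs_le'.2 ⟨tracePairing_le_mul_tensorR hK hT z, ?_⟩
  have h1 := tracePairing_le_mul_tensorR hK hT (-z : X ⊗[ℝ] StrongDual ℝ Y)
  have h2 : tensorR p q (-z : X ⊗[ℝ] StrongDual ℝ Y) = ‖z‖ := norm_neg z
  rw [h2] at h1
  exact (map_neg (tracePairing X Y T) (z : X ⊗[ℝ] StrongDual ℝ Y)).symm.trans_le h1

variable (X Y) in
/-- The bounded functional on `X ⊗_{r_{p,q}} Y*` attached to a `(p, q)`-regular map. -/
noncomputable def regularToDual (p q : ℝ≥0∞) :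
    regularOps X Y p q →ₗ[ℝ] StrongDual ℝ (LatticeTensor X (StrongDual ℝ Y) p q) where
  toFun T := LinearMap.mkContinuousOfExistsBound
    (tracePairing X Y T : LatticeTensor X (StrongDual ℝ Y) p q →ₗ[ℝ] ℝ)
    (by
      obtain ⟨K, hK, hT⟩ := T.2
      exact ⟨K, abs_tracePairing_le hK.le hT⟩)
  map_add' S T := by
    ext z
    exact LinearMap.congr_fun (map_add (tracePairing X Y) (S : X →ₗ[ℝ] Y) T) z
  map_smul' c T := by
    ext z
    exact LinearMap.congr_fun (map_smul (tracePairing X Y) c (T : X →ₗ[ℝ] Y)) z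

theorem regularToDual_latticeTmul {p q : ℝ≥0∞} (T : regularOps X Y p q) (x : X)
    (f : StrongDual ℝ Y) :
    regularToDual X Y p q T (latticeTmul p q x f) = f ((T : X →ₗ[ℝ] Y) x) := rfl

theorem norm_regularToDual_le {p q : ℝ≥0∞} (T : regularOps X Y p q) {K : ℝ} (hK : 0 ≤ K)
    (hT : RegularBound p q (T : X →ₗ[ℝ] Y) K) : ‖regularToDual X Y p q T‖ ≤ K :=
  ContinuousLinearMap.opNorm_le_bound _ hK (abs_tracePairing_le hK hT)

theorem RegularBound.norm_apply_le {p q : ℝ≥0∞} {T : X →ₗ[ℝ] Y} {K : ℝ} (hK : 0 ≤ K)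
    (hT : RegularBound p q T K) (x : X) : ‖T x‖ ≤ K * ‖x‖ :=
  (norm_le_norm_lpSum_single p (T x)).trans ((hT 1 fun _ => x).trans
    (mul_le_mul_of_nonneg_left (norm_lpSum_single_le q x) hK))

theorem regularToDual_mem {p q : ℝ≥0∞} (T : regularOps X Y p q) :
    regularToDual X Y p q T ∈ dualInterOps X Y p q := by
  obtain ⟨K, hK, hT⟩ := T.2
  exact ⟨(T : X →ₗ[ℝ] Y).mkContinuous K (hT.norm_apply_le hK.le), rfl⟩

/-- A linear map that is represented by a bounded functional is regular: test the functional on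
`∑ x i ⊗ f i` with `f` a norming tuple for `T x`. -/
theorem regularBound_of_functional {p q : ℝ≥0∞}
    (φ : StrongDual ℝ (LatticeTensor X (StrongDual ℝ Y) p q)) (T : X →ₗ[ℝ] Y)
    (h : ∀ x f, φ (latticeTmul p q x f) = f (T x)) : RegularBound p q T ‖φ‖ := by
  intro n x
  obtain ⟨f, hf, hfx⟩ := exists_norming_tuple p fun i => T (x i)
  rw [← hfx]
  have h1 : ∑ i, f i (T (x i)) = φ (∑ i, latticeTmul p q (x i) (f i)) := by
    rw [map_sum]
    exact Finset.sum_congr rfl fun i _ => (h _ _).symm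
  have h2 : ‖∑ i, latticeTmul p q (x i) (f i)‖ ≤ ‖lpSum q x‖ := by
    let z : X ⊗[ℝ] StrongDual ℝ Y := ∑ i, x i ⊗ₜ[ℝ] f i
    have h3 : tensorR p q z ≤ tensorPhi p q z := by
      simpa using tensorR_le p q (fun _ : Fin 1 => z) (by simp)
    refine h3.trans ((tensorPhi_le p q x f rfl).trans ?_)
    exact mul_le_of_le_one_right (norm_nonneg _) hf
  rw [h1]
  exact (le_abs_self _).trans ((φ.le_opNorm _).trans
    (mul_le_mul_of_nonneg_left h2 (norm_nonneg _)))

theorem norm_regularToDual {p q : ℝ≥0∞} (T : regularOps X Y p q) :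
    ‖regularToDual X Y p q T‖ = regularNorm p q (T : X →ₗ[ℝ] Y) := by
  have hT := regularBound_of_functional (regularToDual X Y p q T) (T : X →ₗ[ℝ] Y)
    (regularToDual_latticeTmul T)
  refine le_antisymm (le_csInf ⟨_, norm_nonneg _, hT⟩ ?_)
    (csInf_le ⟨0, fun K hK => hK.1⟩ ⟨norm_nonneg _, hT⟩)
  rintro K ⟨hK, hTK⟩
  exact norm_regularToDual_le T hK hTK

theorem LatticeTensor.dual_ext {p q : ℝ≥0∞}
    {φ ψ : StrongDual ℝ (LatticeTensor X (StrongDual ℝ Y) p q)}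
    (h : ∀ x f, φ (latticeTmul p q x f) = ψ (latticeTmul p q x f)) : φ = ψ := by
  ext z
  obtain ⟨n, x, f, hz⟩ := exists_tensor_repr (X := X) (Y := StrongDual ℝ Y) z
  have hz' : z = ∑ i, latticeTmul p q (x i) (f i) := hz
  rw [hz', map_sum, map_sum]
  exact Finset.sum_congr rfl fun i _ => h _ _

end Main

theorem mainTheorem1 {X Y : Type*}
    [NormedAddCommGroup X] [NormedSpace ℝ X] [CompleteSpace X] [Lattice X]
    [IsOrderedAddMonoid X] [HasSolidNorm X] [IsOrderedModule ℝ X]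
    [NormedAddCommGroup Y] [NormedSpace ℝ Y] [CompleteSpace Y] [Lattice Y]
    [IsOrderedAddMonoid Y] [HasSolidNorm Y] [IsOrderedModule ℝ Y]
    (p q : ℝ≥0∞) (hq : 1 ≤ q) (hqp : q ≤ p) :
    ∃ e : regularOps X Y p q ≃ₗ[ℝ] dualInterOps X Y p q,
      (∀ (T : regularOps X Y p q) (x : X),
        traceOp (e T : StrongDual ℝ (LatticeTensor X (StrongDual ℝ Y) p q)) x =
          NormedSpace.inclusionInDoubleDual ℝ Y ((T : X →ₗ[ℝ] Y) x)) ∧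
      ∀ T : regularOps X Y p q,
        ‖(e T : StrongDual ℝ (LatticeTensor X (StrongDual ℝ Y) p q))‖ =
          regularNorm p q (T : X →ₗ[ℝ] Y) := by
  let F : regularOps X Y p q →ₗ[ℝ] dualInterOps X Y p q :=
    (regularToDual X Y p q).codRestrict _ regularToDual_mem
  have hinj : Function.Injective F := by
    intro S T hST
    have h1 : regularToDual X Y p q S = regularToDual X Y p q T := congrArg Subtype.val hST
    refine Subtype.ext (LinearMap.ext fun x => ?_)
    refine (SeparatingDual.eq_iff_forall_dual_eq (R := ℝ)).2 fun f => ?_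
    exact congrArg (fun φ => φ (latticeTmul p q x f)) h1
  have hsurj : Function.Surjective F := by
    rintro ⟨φ, T, hT⟩
    have h : ∀ x f, φ (latticeTmul p q x f) = f (T x) := fun x f => by
      rw [← traceOp_apply, hT]
      rfl
    have hreg := regularBound_of_functional φ (T : X →ₗ[ℝ] Y) h
    refine ⟨⟨T, ‖φ‖ + 1, by positivity, fun n x => (hreg n x).trans ?_⟩, ?_⟩
    · exact mul_le_mul_of_nonneg_right (by linarith) (norm_nonneg _)
    · exact Subtype.ext (LatticeTensor.dual_ext fun x f => (h x f).symm)
  exact ⟨LinearEquiv.ofBijective F ⟨hinj, hsurj⟩, fun T x => rfl, norm_regularToDual⟩
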